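/- A \emph{TGBA} over a finite set $S$ of atomic propositions consists of a finite set of states $Q$, an initial state $\iota\in Q$, a finite set $\mathit{Acc}$ of acceptance marks, and a transition relation $\delta\subseteq Q\times\mathbb B(S)\times 2^{\mathit{Acc}}\times Q$, where $\mathbb B(S)$ is the set of Boolean formulas over $S$. A run on an infinite word $w=\ell_1\ell_2\cdots$ of valuations $\ell_i\in\{\bot,\top\}^S$ is an infinite sequence of connected transitions that starts in $\iota$ and whose $i$-th label is satisfied by $\ell_i$ for every $i$; it is accepting if every mark occurs infinitely often in it. $\mathscr L(A)$ is the set of words that have an accepting run. The product $A_1\otimes A_2$ of TGBAs over $S_1$ and $S_2$ is the usual synchronous product over $S_1\cup S_2$: pairs of states, disjoint union of the sets of marks, and joint transitions that carry the conjunction of the labels and the union of the sets of marks. Two infinite words are stutter-equivalent if they can be cut into infinitely many finite nonempty blocks such that, for each $k$, the $k$-th blocks of both words repeat one and the same letter; $[w]$ is the set of words stutter-equivalent to $w$. A language $L$ is stutter-sensitive if some $[w]$ meets both $L$ and its complement, and stutter-insensitive otherwise; a TGBA is stutter-sensitive if its language is. \textbf{Theorem.} There are operations that turn every TGBA $A$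 into a TGBA $\mathit{si}(A)$ over the same atomic propositions whose language is the smallest stutter-insensitive language containing $\mathscr L(A)$, and into a TGBA $\overline A$ over the same atomic propositions whose language is the complement of $\mathscr L(A)$, and an operation that turns every LTL formula $K$ over a finite set of atomic propositions into a TGBA $A_K$ over that set with $\mathscr L(A_K)=\mathscr L(K)$. For any choice of such operations, let $\mathit{ss}(A)=A\otimes\mathit{si}(\mathit{si}(A)\otimes\overline A)$, let $A$ be a stutter-sensitive TGBA and $K$ an LTL formula (their sets of atomic propositions may differ), and put \[ \mathrm{SIrelax}_{|K}(A)=\begin{cases}\mathit{si}(A)&\text{if }\mathscr L(\mathit{si}(A)\otimes\overline A\otimes A_K)=\emptyset,\\ A&\text{otherwise,}\end{cases} \qquad \mathrm{SIrestrict}_{|K}(A)=\begin{cases}A\otimes\overline{\mathit{ss}(A)}&\text{if }\mathscr L(\mathit{ss}(A)\otimes A_K)=\emptyset,\\ A&\text{otherwise.}\end{cases} \] Then $\mathscr L(\mathrm{SIrelax}_{|K}(A)\otimes A_K)=\mathscr L(\mathrm{SIrestrict}_{|K}(A)\otimes A_K)=\mathscr L(A\otimes A_K)$. -/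

import Mathlib

/-! Atomic propositions are elements of an ambient type `P`; every automaton and every formula
comes with its own finite set `S : Finset P` of atomic propositions. -/

/-- A letter is a valuation of the atomic propositions in `α`. -/
abbrev Letter (α : Type*) := α → Bool

/-- An infinite word over the alphabet of valuations of `α`. -/
abbrev OmegaWord (α : Type*) := ℕ → Letter α

/-- Boolean formulas over the atomic propositions in `α`. -/
inductive BoolFormula (α : Type*) where
  | tru : BoolFormula α
  | fls : BoolFormula α
  | atom (p : α) : BoolFormula α
  | neg (f : BoolFormula α) : BoolFormula α
  | conj (f g : BoolFormula α) : BoolFormula α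
  | disj (f g : BoolFormula α) : BoolFormula α

namespace BoolFormula

/-- The truth value of a Boolean formula under a valuation; `f.eval ℓ = true` is `ℓ ⇒ f`. -/
def eval {α : Type*} (ℓ : Letter α) : BoolFormula α → Bool
  | tru => true
  | fls => false
  | atom p => ℓ p
  | neg f => !(f.eval ℓ)
  | conj f g => f.eval ℓ && g.eval ℓ
  | disj f g => f.eval ℓ || g.eval ℓ

/-- Renaming of atomic propositions, used below only along inclusions. -/
def map {α β : Type*} (r : α → β) : BoolFormula α → BoolFormula β
  | tru => tru
  | fls => fls
  | atom p => atom (r p)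
  | neg f => neg (f.map r)
  | conj f g => conj (f.map r) (g.map r)
  | disj f g => disj (f.map r) (g.map r)

end BoolFormula

/-- Linear-time temporal logic formulas over the atomic propositions in `α`; the other operators
(disjunction, `F`, `G`, `R`, `W`, …) are the usual abbreviations. -/
inductive LTL (α : Type*) where
  | tru : LTL α
  | atom (p : α) : LTL α
  | neg (φ : LTL α) : LTL α
  | conj (φ ψ : LTL α) : LTL α
  | next (φ : LTL α) : LTL α
  | untl (φ ψ : LTL α) : LTL α

namespace LTL

/-- `φ.Sat w i`: the suffix of `w` that starts at position `i` satisfies `φ`. -/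
def Sat {α : Type*} (w : OmegaWord α) : LTL α → ℕ → Prop
  | tru, _ => True
  | atom p, i => w i p = true
  | neg φ, i => ¬ φ.Sat w i
  | conj φ ψ, i => φ.Sat w i ∧ ψ.Sat w i
  | next φ, i => φ.Sat w (i + 1)
  | untl φ ψ, i => ∃ k, i ≤ k ∧ ψ.Sat w k ∧ ∀ j, i ≤ j → j < k → φ.Sat w j

/-- The set of infinite words that satisfy `φ`. -/
def language {α : Type*} (φ : LTL α) : Set (OmegaWord α) := {w | φ.Sat w 0}

end LTL

/-- Two infinite words are stutter-equivalent if they can be cut into the same number of finite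
nonempty blocks so that the `k`-th blocks of both words repeat one and the same letter. -/
def StutterEquiv {Γ : Type*} (w w' : ℕ → Γ) : Prop :=
  ∃ i j : ℕ → ℕ, StrictMono i ∧ StrictMono j ∧ i 0 = 0 ∧ j 0 = 0 ∧
    ∀ k m n, i k ≤ m → m < i (k + 1) → j k ≤ n → n < j (k + 1) → w m = w' n

/-- The class `[w]` of the words that are stutter-equivalent to `w`. -/
def stutterClass {Γ : Type*} (w : ℕ → Γ) : Set (ℕ → Γ) := {w' | StutterEquiv w w'}

/-- A language is stutter-sensitive if it covers some class `[w]` only partly. -/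
def StutterSensitive {Γ : Type*} (L : Set (ℕ → Γ)) : Prop :=
  ∃ w, (stutterClass w ∩ L).Nonempty ∧ (stutterClass w ∩ Lᶜ).Nonempty

/-- A language is stutter-insensitive if it is not stutter-sensitive. -/
def StutterInsensitive {Γ : Type*} (L : Set (ℕ → Γ)) : Prop := ¬ StutterSensitive L

/-- A transition, from `src` to `dst`, with a Boolean formula as label and a set of marks. -/
structure Transition (α Q Acc : Type*) where
  src : Q
  label : BoolFormula α
  marks : Set Acc
  dst : Q

/-- Transition-based generalized Büchi automata with set of atomic propositions `S`. -/
structure TGBA {P : Type*} (S : Finset P) where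
  /-- The states. -/
  Q : Type
  finite_Q : Finite Q
  /-- The initial state. -/
  init : Q
  /-- The acceptance marks. -/
  Acc : Type
  finite_Acc : Finite Acc
  /-- The transition relation. -/
  δ : Set (Transition S Q Acc)

namespace TGBA

variable {P : Type*} {S T U : Finset P}

/-- `ρ` is a run of `A` on the word `w`. -/
def IsRun (A : TGBA S) (w : OmegaWord S) (ρ : ℕ → Transition S A.Q A.Acc) : Prop :=
  (ρ 0).src = A.init ∧
    ∀ i, ρ i ∈ A.δ ∧ (ρ i).dst = (ρ (i + 1)).src ∧ (ρ i).label.eval (w i) = true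

/-- A sequence of transitions is accepting if it contains every mark infinitely often. -/
def IsAccepting (A : TGBA S) (ρ : ℕ → Transition S A.Q A.Acc) : Prop :=
  ∀ m : A.Acc, {i | m ∈ (ρ i).marks}.Infinite

/-- The set of the infinite words on which `A` has an accepting run. -/
def language (A : TGBA S) : Set (OmegaWord S) :=
  {w | ∃ ρ, A.IsRun w ρ ∧ A.IsAccepting ρ}

/-- The product of two automata. Its set of atomic propositions is the union of those of the two
factors: it is called `U`, with `S ∪ T = U`, so that it can be written as `S` when `T = S`. The sets
of marks are made disjoint. -/
def prod [DecidableEq P] (A : TGBA S) (B : TGBA T) (hU : S ∪ T = U) : TGBA U where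
  Q := A.Q × B.Q
  finite_Q := by
    have := A.finite_Q
    have := B.finite_Q
    infer_instance
  init := (A.init, B.init)
  Acc := A.Acc ⊕ B.Acc
  finite_Acc := by
    have := A.finite_Acc
    have := B.finite_Acc
    infer_instance
  δ := {t | ∃ t₁ ∈ A.δ, ∃ t₂ ∈ B.δ, t =
    { src := (t₁.src, t₂.src)
      label := .conj (t₁.label.map fun p => ⟨p.1, hU ▸ Finset.mem_union_left T p.2⟩)
        (t₂.label.map fun p => ⟨p.1, hU ▸ Finset.mem_union_right S p.2⟩)
      marks := Sum.inl '' t₁.marks ∪ Sum.inr '' t₂.marks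
      dst := (t₁.dst, t₂.dst) }}

/-- An operation that turns automata into automata over the same atomic propositions. -/
abbrev Operation (P : Type*) := (S : Finset P) → TGBA S → TGBA S

/-- `co` computes complements. -/
def IsComplementation (co : Operation P) : Prop :=
  ∀ (S : Finset P) (A : TGBA S), (co S A).language = A.languageᶜ

/-- `si A` is, for every `A`, an automaton for the smallest stutter-insensitive language that
contains the language of `A`. -/
def IsStutterClosure (si : Operation P) : Prop :=
  ∀ (S : Finset P) (A : TGBA S),
    IsLeast {L | StutterInsensitive L ∧ A.language ⊆ L} (si S A).language

/-- `tr` turns every LTL formula into an automaton for its language. -/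
def IsTranslation (tr : (S : Finset P) → LTL S → TGBA S) : Prop :=
  ∀ (S : Finset P) (φ : LTL S), (tr S φ).language = φ.language

variable [DecidableEq P]

/-- The stutter-sensitive part `A ⊗ si (si A ⊗ co A)` of `A`. -/
def ss (si co : Operation P) (A : TGBA S) : TGBA S :=
  A.prod (si S ((si S A).prod (co S A) (Finset.union_self S))) (Finset.union_self S)

open Classical in
/-- The SI-relaxation of `A` given a formula whose automaton is `AK`. -/
noncomputable def siRelax (si co : Operation P) (A : TGBA S) (AK : TGBA T) : TGBA S :=
  if (((si S A).prod (co S A) (Finset.union_self S)).prod AK rfl).language = ∅ then si S A else A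

open Classical in
/-- The SI-restriction of `A` given a formula whose automaton is `AK`. -/
noncomputable def siRestrict (si co : Operation P) (A : TGBA S) (AK : TGBA T) : TGBA S :=
  if ((ss si co A).prod AK rfl).language = ∅ then
    A.prod (co S (ss si co A)) (Finset.union_self S)
  else A

end TGBA

open Filter

/-! ### Cutting `ℕ` into consecutive blocks -/

/-! The two equalities are Boolean algebra: a product accepts the words whose restrictions both
factors accept (`mem_language_prod`). If no word satisfying `K` lies in `si A` but outside `A`, the
two agree on `K`; if none lies in `ss A`, removing `ss A` from `A` changes nothing on `K`.

The work is in the existence of the operations. An LTL formula becomes an automaton that guesses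
which subformulas hold, checks the guess locally, and uses marks to forbid postponing an until
forever (`mem_iff_sat`).

Complement and stutter closure both come from automata that guess a cutting of the word into blocks
and see a finite abstraction of each (`exists_language_eq_blocks`). Whether `A` accepts depends only
on the profiles of the blocks (`mem_language_iff_profile`). Complementation is Büchi's: by Ramsey
every word has a cutting with profiles `s, e, e, …`, and the automaton guesses one whose pair `(s,
e)` excludes acceptance. For the closure it guesses constant blocks and lets `A` read each letter
some other positive number of times; this is the least closure because stutter equivalence is an
equivalence relation, shown by a normal form (`stutterEquiv_iff`). -/

theorem StrictMono.block_unique {i : ℕ → ℕ} (hi : StrictMono i) {k k' n : ℕ}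
    (h₁ : i k ≤ n) (h₂ : n < i (k + 1)) (h₁' : i k' ≤ n) (h₂' : n < i (k' + 1)) : k = k' := by
  have h := hi.lt_iff_lt.1 (h₁.trans_lt h₂')
  have h' := hi.lt_iff_lt.1 (h₁'.trans_lt h₂)
  omega

theorem StrictMono.exists_blockIndex {i : ℕ → ℕ} (hi : StrictMono i) (h0 : i 0 = 0) :
    ∃ κ : ℕ → ℕ, ∀ n, i (κ n) ≤ n ∧ n < i (κ n + 1) := by
  have (n : ℕ) : ∃ k, i k ≤ n ∧ n < i (k + 1) := by
    have hex : ∃ k, n < i (k + 1) := ⟨n, (Nat.lt_succ_self n).trans_le (hi.id_le (n + 1))⟩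
    classical
    refine ⟨Nat.find hex, ?_, Nat.find_spec hex⟩
    rcases h : Nat.find hex with _ | k
    · omega
    · exact not_lt.1 (Nat.find_min hex (m := k) (by omega))
  choose κ hκ using this
  exact ⟨κ, hκ⟩

theorem blockIndex_eq {i κ : ℕ → ℕ} (hi : StrictMono i)
    (hκ : ∀ n, i (κ n) ≤ n ∧ n < i (κ n + 1)) {k n : ℕ}
    (h₁ : i k ≤ n) (h₂ : n < i (k + 1)) : κ n = k :=
  hi.block_unique (hκ n).1 (hκ n).2 h₁ h₂

theorem blockIndex_cut {i κ : ℕ → ℕ} (hi : StrictMono i)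
    (hκ : ∀ n, i (κ n) ≤ n ∧ n < i (κ n + 1)) (k : ℕ) : κ (i k) = k :=
  blockIndex_eq hi hκ le_rfl (hi (Nat.lt_succ_self k))

theorem blockIndex_mono {i κ : ℕ → ℕ} (hi : StrictMono i)
    (hκ : ∀ n, i (κ n) ≤ n ∧ n < i (κ n + 1)) : Monotone κ := by
  intro m n hmn
  have := hi.lt_iff_lt.1 (((hκ m).1.trans hmn).trans_lt (hκ n).2)
  omega

theorem blockIndex_succ {i κ : ℕ → ℕ} (hi : StrictMono i)
    (hκ : ∀ n, i (κ n) ≤ n ∧ n < i (κ n + 1)) (n : ℕ) :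
    (κ (n + 1) = κ n ∧ n + 1 < i (κ n + 1)) ∨ (κ (n + 1) = κ n + 1 ∧ n + 1 = i (κ n + 1)) := by
  rcases (Nat.succ_le_of_lt (hκ n).2).lt_or_eq with h | h
  · exact .inl ⟨blockIndex_eq hi hκ ((hκ n).1.trans (Nat.le_succ n)) h, h⟩
  · refine .inr ⟨?_, h⟩
    have := blockIndex_cut hi hκ (κ n + 1)
    rwa [← h] at this

/-! ### Stutter equivalence is an equivalence relation -/

section Stutter

variable {Γ : Type*}

open Classical in
/-- The length of the first block of `w`; this is `1` if `w` is constant. -/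
noncomputable def firstChange (w : ℕ → Γ) : ℕ :=
  if h : ∃ m, w m ≠ w 0 then Nat.find h else 1

/-- The word `w` without its first block. -/
noncomputable def dropBlock (w : ℕ → Γ) : ℕ → Γ := fun n => w (firstChange w + n)

/-- The word that keeps one letter of every block of `w`. -/
noncomputable def destutter (w : ℕ → Γ) : ℕ → Γ := fun k => (dropBlock^[k] w) 0

theorem firstChange_pos (w : ℕ → Γ) : 0 < firstChange w := by
  classical
  unfold firstChange
  split_ifs with h
  · rw [Nat.find_pos]
    simp
  · exact one_pos

theorem eq_of_lt_firstChange {w : ℕ → Γ} {n : ℕ} (h : n < firstChange w) : w n = w 0 := by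
  classical
  unfold firstChange at h
  split_ifs at h with h'
  · simpa using Nat.find_min h' h
  · push Not at h'
    exact h' n

/-- `w` arises from `v` by repeating letters. -/
def Stretches (w v : ℕ → Γ) : Prop :=
  ∃ f : ℕ → ℕ, Monotone f ∧ Function.Surjective f ∧ ∀ n, w n = v (f n)

theorem Stretches.zero {w v : ℕ → Γ} (h : Stretches w v) : w 0 = v 0 := by
  obtain ⟨f, hf, hs, hw⟩ := h
  obtain ⟨n, hn⟩ := hs 0
  have : f 0 = 0 := by
    have := hf (Nat.zero_le n)
    omega
  rw [hw, this]

/-- If `w = v ∘ f` first changes at `m`, then `v` first changes at `f m`, and `n ↦ f (m + n) - f m`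
relates the remainders. Constant words are unaffected by dropping letters. -/
theorem Stretches.dropBlock {w v : ℕ → Γ} (h : Stretches w v) :
    Stretches (dropBlock w) (dropBlock v) := by
  classical
  have h0 := h.zero
  obtain ⟨f, hf, hs, hw⟩ := h
  by_cases hc : ∃ m, w m ≠ w 0
  · have hcv : ∃ m, v m ≠ v 0 := by
      obtain ⟨m, hm⟩ := hc
      exact ⟨f m, by rwa [← hw, ← h0]⟩
    obtain ⟨m, hm⟩ : ∃ m, m = firstChange w := ⟨_, rfl⟩
    have hm1 : w m ≠ w 0 := by
      rw [hm, firstChange, dif_pos hc]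
      exact Nat.find_spec hc
    have hv : firstChange v = f m := by
      rw [firstChange, dif_pos hcv, Nat.find_eq_iff]
      refine ⟨by rwa [← hw, ← h0], fun j hj => ?_⟩
      obtain ⟨n, rfl⟩ := hs j
      have hn : n < m := by
        by_contra! hn
        exact absurd (hf hn) (by omega)
      rw [not_not, ← hw, ← h0]
      exact eq_of_lt_firstChange (hm ▸ hn)
    refine ⟨fun n => f (m + n) - f m, fun a b hab => ?_, fun k => ?_, fun n => ?_⟩
    · have := hf (Nat.add_le_add_left hab m)
      exact Nat.sub_le_sub_right this _
    · obtain ⟨n, hn⟩ := hs (f m + k)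
      rcases le_total m n with h | h
      · refine ⟨n - m, ?_⟩
        simp only [Nat.add_sub_cancel' h]
        omega
      · have := hf h
        refine ⟨0, ?_⟩
        simp only [Nat.add_zero]
        omega
    · have := hf (Nat.le_add_right m n)
      simp only [_root_.dropBlock, ← hm, hv, hw]
      congr 1
      omega
  · push Not at hc
    have hv (n : ℕ) : v n = v 0 := by
      obtain ⟨m, rfl⟩ := hs n
      rw [← hw, hc, h0]
    refine ⟨id, monotone_id, Function.surjective_id, fun n => ?_⟩
    simp only [_root_.dropBlock]
    rw [hc, hv, h0]

theorem Stretches.destutter_eq {w v : ℕ → Γ} (h : Stretches w v) : destutter w = destutter v := by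
  have (k : ℕ) : Stretches (_root_.dropBlock^[k] w) (_root_.dropBlock^[k] v) := by
    induction k with
    | zero => exact h
    | succ k ih =>
      rw [Function.iterate_succ_apply', Function.iterate_succ_apply']
      exact ih.dropBlock
  funext k
  exact (this k).zero

/-- The cuts are partial sums of block lengths. On an eventually constant word the default length
`1` keeps them going forever. -/
theorem exists_cuts_destutter (w : ℕ → Γ) :
    ∃ i : ℕ → ℕ, StrictMono i ∧ i 0 = 0 ∧
      ∀ k m, i k ≤ m → m < i (k + 1) → w m = destutter w k := by
  let i : ℕ → ℕ := Nat.rec 0 fun k n => n + firstChange (dropBlock^[k] w)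
  have hs (k : ℕ) : i (k + 1) = i k + firstChange (dropBlock^[k] w) := rfl
  have hd (k n : ℕ) : (dropBlock^[k] w) n = w (i k + n) := by
    induction k generalizing n with
    | zero => simp [i]
    | succ k ih =>
      rw [Function.iterate_succ_apply', hs]
      simp only [dropBlock]
      rw [ih, add_assoc]
  refine ⟨i, strictMono_nat_of_lt_succ fun k => ?_, rfl, fun k m h₁ h₂ => ?_⟩
  · rw [hs]
    exact Nat.lt_add_of_pos_right (firstChange_pos _)
  · rw [hs] at h₂
    obtain ⟨n, rfl⟩ := Nat.exists_eq_add_of_le h₁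
    have hn : n < firstChange (dropBlock^[k] w) := by omega
    rw [← hd, eq_of_lt_firstChange hn]
    rfl

/-- A normal form gives symmetry and transitivity at once, with no common refinement of two
cuttings. -/
theorem stutterEquiv_iff {w w' : ℕ → Γ} : StutterEquiv w w' ↔ destutter w = destutter w' := by
  constructor
  · rintro ⟨i, j, hi, hj, hi0, hj0, h⟩
    obtain ⟨κ, hκ⟩ := hi.exists_blockIndex hi0
    obtain ⟨μ, hμ⟩ := hj.exists_blockIndex hj0
    have hlt (k : ℕ) : i k < i (k + 1) := hi (Nat.lt_succ_self k)
    have hlt' (k : ℕ) : j k < j (k + 1) := hj (Nat.lt_succ_self k)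
    -- Both words stretch the word that keeps one letter per given block; that word may still repeat
    -- letters.
    have h₁ : Stretches w (fun k => w (i k)) :=
      ⟨κ, blockIndex_mono hi hκ, fun k => ⟨i k, blockIndex_cut hi hκ k⟩, fun n =>
        (h _ _ _ (hκ n).1 (hκ n).2 le_rfl (hlt' _)).trans (h _ _ _ le_rfl (hlt _) le_rfl (hlt' _)).symm⟩
    have h₂ : Stretches w' (fun k => w (i k)) :=
      ⟨μ, blockIndex_mono hj hμ, fun k => ⟨j k, blockIndex_cut hj hμ k⟩, fun n =>
        (h _ _ _ le_rfl (hlt _) (hμ n).1 (hμ n).2).symm⟩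
    rw [h₁.destutter_eq, h₂.destutter_eq]
  · intro h
    obtain ⟨i, hi, hi0, hw⟩ := exists_cuts_destutter w
    obtain ⟨j, hj, hj0, hw'⟩ := exists_cuts_destutter w'
    refine ⟨i, j, hi, hj, hi0, hj0, fun k m n h₁ h₂ h₃ h₄ => ?_⟩
    rw [hw k m h₁ h₂, hw' k n h₃ h₄, h]

/-- Insensitive languages are the unions of equivalence classes, so the least one above `L` is its
saturation. -/
theorem isLeast_stutterClosure (L : Set (ℕ → Γ)) :
    IsLeast {L' | StutterInsensitive L' ∧ L ⊆ L'} {w | ∃ w' ∈ L, StutterEquiv w w'} := by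
  refine ⟨⟨?_, fun w hw => ⟨w, hw, stutterEquiv_iff.2 rfl⟩⟩, ?_⟩
  · rintro ⟨w, ⟨x, hx, y, hy, hxy⟩, ⟨z, hz, hz'⟩⟩
    refine hz' ⟨y, hy, ?_⟩
    simp only [stutterClass, Set.mem_ofPred_eq, stutterEquiv_iff] at *
    rw [← hz, hx, hxy]
  · rintro L' ⟨hL', hLL'⟩ w ⟨w', hw', h⟩
    by_contra hw
    exact hL' ⟨w, ⟨w', h, hLL' hw'⟩, ⟨w, stutterEquiv_iff.2 rfl, hw⟩⟩

end Stutter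

/-! ### Automata from finite transition systems -/

/-- A conjunction of literals, so that a Boolean label can single out one letter. -/
theorem BoolFormula.exists_eval_eq_true_iff {α : Type*} [Finite α] (ℓ : Letter α) :
    ∃ f : BoolFormula α, ∀ ℓ' : Letter α, f.eval ℓ' = true ↔ ℓ' = ℓ := by
  classical
  have := Fintype.ofFinite α
  have key (s : Finset α) :
      ∃ f : BoolFormula α, ∀ ℓ' : Letter α, f.eval ℓ' = true ↔ ∀ p ∈ s, ℓ' p = ℓ p := by
    induction s using Finset.induction_on with
    | empty => exact ⟨.tru, fun ℓ' => by simp [eval]⟩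
    | insert a s _ ih =>
      obtain ⟨f, hf⟩ := ih
      refine ⟨.conj (if ℓ a then .atom a else .neg (.atom a)) f, fun ℓ' => ?_⟩
      rw [Finset.forall_mem_insert, ← hf]
      cases h : ℓ a <;> simp [eval]
  obtain ⟨f, hf⟩ := key Finset.univ
  exact ⟨f, fun ℓ' => by simp [hf, funext_iff]⟩

theorem frequently_succ_iff {p : ℕ → Prop} :
    (∃ᶠ n in atTop, p (n + 1)) ↔ ∃ᶠ n in atTop, p n := by
  simp only [frequently_atTop]
  constructor
  · intro h a
    obtain ⟨b, hb, hp⟩ := h a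
    exact ⟨b + 1, by omega, hp⟩
  · intro h a
    obtain ⟨b, hb, hp⟩ := h (a + 1)
    exact ⟨b - 1, by omega, by rwa [Nat.sub_add_cancel (by omega)]⟩

namespace TGBA

variable {P : Type*} {S : Finset P}

/-- `A` has a transition from `p` to `q` with the marks `M` whose label is satisfied by `ℓ`. -/
def Step (A : TGBA S) (p : A.Q) (ℓ : Letter S) (M : Set A.Acc) (q : A.Q) : Prop :=
  ∃ f : BoolFormula S, f.eval ℓ = true ∧ ⟨p, f, M, q⟩ ∈ A.δ

theorem mem_language_iff {A : TGBA S} {w : OmegaWord S} :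
    w ∈ A.language ↔ ∃ (q : ℕ → A.Q) (M : ℕ → Set A.Acc), q 0 = A.init ∧
      (∀ n, A.Step (q n) (w n) (M n) (q (n + 1))) ∧ ∀ m, ∃ᶠ n in atTop, m ∈ M n := by
  simp only [Nat.frequently_atTop_iff_infinite]
  constructor
  · rintro ⟨ρ, ⟨h0, hρ⟩, hacc⟩
    refine ⟨fun n => (ρ n).src, fun n => (ρ n).marks, h0, fun n => ?_, hacc⟩
    obtain ⟨h₁, h₂, h₃⟩ := hρ n
    exact ⟨(ρ n).label, h₃, by dsimp only; rw [← h₂]; exact h₁⟩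
  · rintro ⟨q, M, h0, hstep, hacc⟩
    choose f hf hδ using hstep
    exact ⟨fun n => ⟨q n, f n, M n, q (n + 1)⟩, ⟨h0, fun n => ⟨hδ n, rfl, hf n⟩⟩, hacc⟩

/-- A finite transition system with sets of initial states and of accepting states is equivalent
to an automaton. -/
theorem exists_language_eq {Q Acc : Type*} [Finite Q] [Finite Acc] (I : Set Q)
    (step : Q → Letter S → Q → Prop) (F : Acc → Set Q) :
    ∃ A : TGBA S, A.language = {w | ∃ q : ℕ → Q, q 0 ∈ I ∧
      (∀ n, step (q n) (w n) (q (n + 1))) ∧ ∀ m, ∃ᶠ n in atTop, q n ∈ F m} := by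
  -- Copies in `Fin` bring states and marks into `Type`. The fresh state `none` imitates every state
  -- in `I`, and marks are read off the target of a transition, hence the shifts by one below.
  let e := Finite.equivFin Q
  let e' := Finite.equivFin Acc
  let A : TGBA S :=
    { Q := Option (Fin (Nat.card Q))
      finite_Q := inferInstance
      init := none
      Acc := Fin (Nat.card Acc)
      finite_Acc := inferInstance
      δ := {t | ∃ q, t.dst = some (e q) ∧ t.marks = {m | q ∈ F (e'.symm m)} ∧
        ∃ p, (t.src = some (e p) ∨ t.src = none ∧ p ∈ I) ∧
          ∀ ℓ, t.label.eval ℓ = true → step p ℓ q} }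
  refine ⟨A, Set.ext fun w => ?_⟩
  rw [mem_language_iff]
  constructor
  · rintro ⟨q, M, h0, hstep, hacc⟩
    choose f hf r hr hM p hp hs using hstep
    dsimp only at hr hM hp hs
    have hp0 : p 0 ∈ I := by
      rcases hp 0 with h | h
      · rw [h0] at h
        cases h
      · exact h.2
    have hpr (n : ℕ) : p (n + 1) = r n := by
      rcases hp (n + 1) with h | h
      · rw [hr n] at h
        exact (e.injective (Option.some.inj h)).symm
      · rw [hr n] at h
        cases h.1
    refine ⟨p, hp0, fun n => ?_, fun m => ?_⟩
    · rw [hpr]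
      exact hs n _ (hf n)
    · rw [← frequently_succ_iff]
      refine (hacc (e' m)).mono fun n hn => ?_
      have hn' : r n ∈ F (e'.symm (e' m)) := by
        rw [hM] at hn
        exact hn
      rwa [Equiv.symm_apply_apply, ← hpr] at hn'
  · rintro ⟨q, h0, hstep, hacc⟩
    refine ⟨fun n => if n = 0 then none else some (e (q n)),
      fun n => {m | q (n + 1) ∈ F (e'.symm m)}, rfl, fun n => ?_, fun m => ?_⟩
    · obtain ⟨f, hf⟩ := BoolFormula.exists_eval_eq_true_iff (w n)
      refine ⟨f, (hf _).2 rfl, q (n + 1), by simp, rfl, q n, ?_, fun ℓ hℓ => ?_⟩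
      · rcases n with _ | n
        · exact .inr ⟨rfl, h0⟩
        · exact .inl rfl
      · rw [(hf ℓ).1 hℓ]
        exact hstep n
    · exact frequently_succ_iff (p := fun n => q n ∈ F (e'.symm m)).2 (hacc _)

end TGBA

/-! ### Translation of linear-time temporal logic -/

namespace LTL

variable {α : Type*}

/-- The set of subformulas. -/
def sub : LTL α → Set (LTL α)
  | tru => {tru}
  | atom p => {atom p}
  | neg φ => insert (neg φ) φ.sub
  | conj φ ψ => insert (conj φ ψ) (φ.sub ∪ ψ.sub)
  | next φ => insert (next φ) φ.sub
  | untl φ ψ => insert (untl φ ψ) (φ.sub ∪ ψ.sub)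

theorem sub_finite (φ : LTL α) : φ.sub.Finite := by
  induction φ with
  | tru => exact Set.finite_singleton _
  | atom p => exact Set.finite_singleton _
  | neg φ ih => exact ih.insert _
  | conj φ ψ ih₁ ih₂ => exact (ih₁.union ih₂).insert _
  | next φ ih => exact ih.insert _
  | untl φ ψ ih₁ ih₂ => exact (ih₁.union ih₂).insert _

theorem mem_sub_self (φ : LTL α) : φ ∈ φ.sub := by
  cases φ <;> simp [sub]

theorem sub_subset_sub {φ ψ : LTL α} (h : ψ ∈ φ.sub) : ψ.sub ⊆ φ.sub := by
  induction φ with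
  | tru => cases h; rfl
  | atom p => cases h; rfl
  | neg φ ih =>
    rcases h with rfl | h
    · rfl
    · exact (ih h).trans (Set.subset_insert _ _)
  | conj φ χ ih₁ ih₂ =>
    rcases h with rfl | h | h
    · rfl
    · exact (ih₁ h).trans (Set.subset_union_left.trans (Set.subset_insert _ _))
    · exact (ih₂ h).trans (Set.subset_union_right.trans (Set.subset_insert _ _))
  | next φ ih =>
    rcases h with rfl | h
    · rfl
    · exact (ih h).trans (Set.subset_insert _ _)
  | untl φ χ ih₁ ih₂ =>
    rcases h with rfl | h | h
    · rfl
    · exact (ih₁ h).trans (Set.subset_union_left.trans (Set.subset_insert _ _))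
    · exact (ih₂ h).trans (Set.subset_union_right.trans (Set.subset_insert _ _))

/-- The condition that the truth of `φ` at a position imposes on the set `s` of formulas that hold
there, on the letter `ℓ` there and on the set `s'` of formulas that hold at the next position. -/
def Local (s : Set (LTL α)) (ℓ : Letter α) (s' : Set (LTL α)) : LTL α → Prop
  | tru => True
  | atom p => ℓ p = true
  | neg φ => φ ∉ s
  | conj φ ψ => φ ∈ s ∧ ψ ∈ s
  | next φ => φ ∈ s'
  | untl φ ψ => ψ ∈ s ∨ φ ∈ s ∧ untl φ ψ ∈ s'

/-- The sets of formulas that do not postpone the formula if it is an until. -/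
def fulfilled : LTL α → Set (Set (LTL α))
  | untl φ ψ => {s | untl φ ψ ∉ s ∨ ψ ∈ s}
  | _ => Set.univ

theorem sat_untl_iff {w : OmegaWord α} {φ ψ : LTL α} {i : ℕ} :
    (untl φ ψ).Sat w i ↔ ψ.Sat w i ∨ φ.Sat w i ∧ (untl φ ψ).Sat w (i + 1) := by
  simp only [Sat]
  constructor
  · rintro ⟨k, hk, hψ, hφ⟩
    rcases hk.eq_or_lt with rfl | h
    · exact .inl hψ
    · exact .inr ⟨hφ i le_rfl h, k, h, hψ, fun j hj => hφ j (by omega)⟩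
  · rintro (h | ⟨h, k, hk, hψ, hφ⟩)
    · exact ⟨i, le_rfl, h, fun j h₁ h₂ => by omega⟩
    · refine ⟨k, by omega, hψ, fun j h₁ h₂ => ?_⟩
      rcases h₁.eq_or_lt with rfl | h'
      · exact h
      · exact hφ j h' h₂

/-- Local consistency alone determines everything but untils, whose expansion law also allows
endless postponement; `hF` excludes that. -/
theorem mem_iff_sat {w : OmegaWord α} {φ : LTL α} {s : ℕ → Set (LTL α)}
    (hs : ∀ n, ∀ ψ ∈ φ.sub, ψ ∈ s n ↔ Local (s n) (w n) (s (n + 1)) ψ)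
    (hF : ∀ ψ ∈ φ.sub, ∃ᶠ n in atTop, s n ∈ fulfilled ψ) :
    ∀ ψ ∈ φ.sub, ∀ n, ψ ∈ s n ↔ ψ.Sat w n := by
  intro ψ hψ
  induction ψ with
  | tru => intro n; rw [hs n _ hψ]; rfl
  | atom p => intro n; rw [hs n _ hψ]; rfl
  | neg χ ih =>
    intro n
    rw [hs n _ hψ]
    exact not_congr (ih (sub_subset_sub hψ (.inr χ.mem_sub_self)) n)
  | conj χ θ ih₁ ih₂ =>
    intro n
    rw [hs n _ hψ]
    exact and_congr (ih₁ (sub_subset_sub hψ (.inr (.inl χ.mem_sub_self))) n)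
      (ih₂ (sub_subset_sub hψ (.inr (.inr θ.mem_sub_self))) n)
  | next χ ih =>
    intro n
    rw [hs n _ hψ]
    exact ih (sub_subset_sub hψ (.inr χ.mem_sub_self)) (n + 1)
  | untl χ θ ih₁ ih₂ =>
    have h₁ := ih₁ (sub_subset_sub hψ (.inr (.inl χ.mem_sub_self)))
    have h₂ := ih₂ (sub_subset_sub hψ (.inr (.inr θ.mem_sub_self)))
    have hu (n : ℕ) : untl χ θ ∈ s n ↔ θ.Sat w n ∨ χ.Sat w n ∧ untl χ θ ∈ s (n + 1) := by
      rw [hs n _ hψ, Local, h₁, h₂]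
    intro n
    constructor
    · intro hn
      -- Induction on the distance to a later position where the until is not postponed.
      obtain ⟨m, hm, hm'⟩ := frequently_atTop.1 (hF _ hψ) n
      obtain ⟨d, rfl⟩ := Nat.exists_eq_add_of_le hm
      clear hm
      induction d generalizing n with
      | zero => exact sat_untl_iff.2 (.inl ((h₂ n).1 (hm'.resolve_left (not_not.2 hn))))
      | succ d ih =>
        rw [sat_untl_iff]
        refine ((hu n).1 hn).imp_right fun h => ⟨h.1, ih (n + 1) h.2 ?_⟩
        rwa [show n + 1 + d = n + (d + 1) by omega]
    · rintro ⟨k, hk, hθ, hχ⟩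
      obtain ⟨d, rfl⟩ := Nat.exists_eq_add_of_le hk
      clear hk
      induction d generalizing n with
      | zero => exact (hu n).2 (.inl hθ)
      | succ d ih =>
        refine (hu n).2 (.inr ⟨hχ n le_rfl (by omega), ih (n + 1) ?_ fun j hj hj' => ?_⟩)
        · rwa [show n + 1 + d = n + (d + 1) by omega]
        · exact hχ j (by omega) (by omega)

theorem exists_language_eq {P : Type*} {S : Finset P} (φ : LTL S) :
    ∃ A : TGBA S, A.language = φ.language := by
  have : Finite {s : Set (LTL S) // s ⊆ φ.sub} := φ.sub_finite.finite_subsets.to_subtype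
  have : Finite φ.sub := φ.sub_finite.to_subtype
  obtain ⟨A, hA⟩ := TGBA.exists_language_eq (S := S) (Q := {s : Set (LTL S) // s ⊆ φ.sub})
    (Acc := φ.sub) {s | φ ∈ s.1} (fun s ℓ s' => ∀ ψ ∈ φ.sub, ψ ∈ s.1 ↔ Local s.1 ℓ s'.1 ψ)
    (fun ψ => {s | s.1 ∈ fulfilled ψ.1})
  refine ⟨A, hA.trans (Set.ext fun w => ?_)⟩
  constructor
  · rintro ⟨s, h0, hs, hF⟩
    exact (mem_iff_sat hs (fun ψ hψ => hF ⟨ψ, hψ⟩) φ φ.mem_sub_self 0).1 h0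
  · intro hw
    have hmem {n : ℕ} {ψ : LTL S} (hψ : ψ ∈ φ.sub) :
        ψ ∈ {ψ ∈ φ.sub | ψ.Sat w n} ↔ ψ.Sat w n := and_iff_right hψ
    refine ⟨fun n => ⟨{ψ ∈ φ.sub | ψ.Sat w n}, Set.sep_subset _ _⟩, ⟨φ.mem_sub_self, hw⟩,
      fun n ψ hψ => ?_, fun ψ => ?_⟩
    · rw [hmem hψ]
      cases ψ with
      | tru => rfl
      | atom p => rfl
      | neg χ =>
        rw [Local, hmem (sub_subset_sub hψ (.inr χ.mem_sub_self))]
        rfl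
      | conj χ θ =>
        rw [Local, hmem (sub_subset_sub hψ (.inr (.inl χ.mem_sub_self))),
          hmem (sub_subset_sub hψ (.inr (.inr θ.mem_sub_self)))]
        rfl
      | next χ =>
        rw [Local, hmem (sub_subset_sub hψ (.inr χ.mem_sub_self))]
        rfl
      | untl χ θ =>
        rw [Local, hmem (sub_subset_sub hψ (.inr (.inl χ.mem_sub_self))),
          hmem (sub_subset_sub hψ (.inr (.inr θ.mem_sub_self))), hmem hψ, sat_untl_iff]
    · obtain ⟨ψ, hψ⟩ := ψ
      rw [frequently_atTop]
      intro n
      cases ψ with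
      | untl χ θ =>
        -- The true guess is fair: either the until fails at `n`, or its witness fulfils it.
        by_cases h : (untl χ θ).Sat w n
        · obtain ⟨k, hk, hθ, -⟩ := h
          exact ⟨k, hk, .inr ⟨sub_subset_sub hψ (.inr (.inr θ.mem_sub_self)), hθ⟩⟩
        · exact ⟨n, le_rfl, .inl fun h' => h h'.2⟩
      | _ => exact ⟨n, le_rfl, trivial⟩

end LTL

/-! ### Automata that read words block by block -/

/-- The state that an automaton with initial state `c₀` and transition function `f` reaches by
reading the letters of `w` at the positions from `n` to `m - 1`. -/
def blockFold {C Λ : Type*} (c₀ : C) (f : C → Λ → C) (w : ℕ → Λ) (n : ℕ) : ℕ → C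
  | 0 => c₀
  | m + 1 => if n ≤ m then f (blockFold c₀ f w n m) (w m) else c₀

section BlockFold

variable {C Λ : Type*} (c₀ : C) (f : C → Λ → C) (w : ℕ → Λ)

theorem blockFold_self (n : ℕ) : blockFold c₀ f w n n = c₀ := by
  cases n with
  | zero => rfl
  | succ n => exact if_neg (by omega)

theorem blockFold_succ {n m : ℕ} (h : n ≤ m) :
    blockFold c₀ f w n (m + 1) = f (blockFold c₀ f w n m) (w m) :=
  if_pos h

theorem blockFold_congr {w w' : ℕ → Λ} {n n' d : ℕ} (h : ∀ k < d, w (n + k) = w' (n' + k)) :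
    blockFold c₀ f w n (n + d) = blockFold c₀ f w' n' (n' + d) := by
  induction d with
  | zero => rw [add_zero, add_zero, blockFold_self, blockFold_self]
  | succ d ih =>
    rw [← add_assoc, ← add_assoc, blockFold_succ _ _ _ (Nat.le_add_right _ _),
      blockFold_succ _ _ _ (Nat.le_add_right _ _), ih fun k hk => h k (by omega),
      h d (Nat.lt_succ_self d)]

/-- Collecting the letters of a block serves to test that the block is constant. -/
theorem mem_blockFold_insert {n m : ℕ} (h : n ≤ m) {ℓ : Λ} :
    ℓ ∈ blockFold (∅ : Set Λ) (fun X ℓ => insert ℓ X) w n m ↔ ∃ k, n ≤ k ∧ k < m ∧ w k = ℓ := by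
  induction m, h using Nat.le_induction with
  | base =>
    rw [blockFold_self]
    constructor
    · exact False.elim
    · rintro ⟨k, h₁, h₂, -⟩
      omega
  | succ m hm ih =>
    rw [blockFold_succ _ _ _ hm, Set.mem_insert_iff, ih]
    constructor
    · rintro (rfl | ⟨k, h₁, h₂, rfl⟩)
      · exact ⟨m, hm, Nat.lt_succ_self m, rfl⟩
      · exact ⟨k, h₁, by omega, rfl⟩
    · rintro ⟨k, h₁, h₂, rfl⟩
      rcases (Nat.lt_succ_iff.1 h₂).eq_or_lt with rfl | h
      · exact .inl rfl
      · exact .inr ⟨k, h₁, h, rfl⟩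

end BlockFold

namespace TGBA

variable {P : Type*} {S : Finset P}

/-- A finite transition system that reads words block by block, and sees of every block only the
state of a finite automaton, is equivalent to an automaton. -/
theorem exists_language_eq_blocks {C Q Acc : Type*} [Finite C] [Finite Q] [Finite Acc] (c₀ : C)
    (f : C → Letter S → C) (I : Set Q) (R : Q → C → Q → Prop) (F : Acc → Set Q) :
    ∃ A : TGBA S, A.language = {w | ∃ (i : ℕ → ℕ) (q : ℕ → Q), StrictMono i ∧ i 0 = 0 ∧ q 0 ∈ I ∧
      (∀ k, R (q k) (blockFold c₀ f w (i k) (i (k + 1))) (q (k + 1))) ∧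
      ∀ m, ∃ᶠ k in atTop, q k ∈ F m} := by
  -- A state holds the state of the system at the last cut, the fold since then, and whether a cut
  -- is here. The extra mark `none` forces infinitely many cuts.
  obtain ⟨A, hA⟩ := TGBA.exists_language_eq (S := S) (Q := Q × C × Prop) (Acc := Option Acc)
    {x | x.1 ∈ I ∧ x.2.1 = c₀ ∧ x.2.2}
    (fun x ℓ y => (y.2.2 ∧ R x.1 (f x.2.1 ℓ) y.1 ∧ y.2.1 = c₀) ∨
      (¬ y.2.2 ∧ y.1 = x.1 ∧ y.2.1 = f x.2.1 ℓ))
    (fun m => {x | x.2.2 ∧ ∀ a ∈ m, x.1 ∈ F a})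
  refine ⟨A, hA.trans (Set.ext fun w => ?_)⟩
  constructor
  · rintro ⟨x, ⟨h0, h0', h0''⟩, hstep, hacc⟩
    have hinf : {n | (x n).2.2}.Infinite :=
      Nat.frequently_atTop_iff_infinite.1 ((hacc none).mono fun n hn => hn.1)
    have hi := Nat.nth_strictMono hinf
    have hnth (n : ℕ) (hn : (x n).2.2) : ∃ k, Nat.nth (fun n => (x n).2.2) k = n := by
      have : n ∈ Set.range (Nat.nth fun n => (x n).2.2) := by
        rw [Nat.range_nth_of_infinite hinf]
        exact hn
      exact this
    have hp (k : ℕ) : (x (Nat.nth (fun n => (x n).2.2) k)).2.2 := Nat.nth_mem_of_infinite hinf k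
    have hi0 : Nat.nth (fun n => (x n).2.2) 0 = 0 := Nat.nth_zero_of_zero h0''
    generalize Nat.nth (fun n => (x n).2.2) = i at *
    have hc (n : ℕ) (hn : (x n).2.2) : (x n).2.1 = c₀ := by
      rcases n with _ | n
      · exact h0'
      · exact ((hstep n).resolve_right fun h => h.1 hn).2.2
    have hblock (k n : ℕ) (h : i k ≤ n) : n < i (k + 1) →
        (x n).1 = (x (i k)).1 ∧ (x n).2.1 = blockFold c₀ f w (i k) n := by
      induction n, h using Nat.le_induction with
      | base => exact fun _ => ⟨rfl, by rw [blockFold_self, hc _ (hp k)]⟩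
      | succ n hn ih =>
        intro h
        obtain ⟨h₁, h₂⟩ := ih (by omega)
        rcases hstep n with h' | ⟨-, h₃, h₄⟩
        -- A flag here would be a cut strictly between two consecutive cuts.
        · obtain ⟨k', hk'⟩ := hnth _ h'.1
          have := hi.lt_iff_lt.1 (show i k < i k' by omega)
          have := hi.lt_iff_lt.1 (show i k' < i (k + 1) by omega)
          omega
        · rw [h₃, h₄, h₁, h₂, blockFold_succ _ _ _ hn]
          exact ⟨rfl, rfl⟩
    refine ⟨i, fun k => (x (i k)).1, hi, hi0, by simpa only [hi0] using h0, fun k => ?_, fun m => ?_⟩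
    · have hlt : i k < i (k + 1) := hi (Nat.lt_succ_self k)
      obtain ⟨n, hn⟩ : ∃ n, i (k + 1) = n + 1 := ⟨i (k + 1) - 1, by omega⟩
      obtain ⟨h₁, h₂⟩ := hblock k n (by omega) (by omega)
      have hpk := hp (k + 1)
      dsimp only
      rw [hn] at hpk ⊢
      have := ((hstep n).resolve_right fun h => h.1 hpk).2.1
      rwa [h₁, h₂, ← blockFold_succ c₀ f w (show i k ≤ n by omega)] at this
    · rw [frequently_atTop]
      intro a
      obtain ⟨n, hn, hn', hF⟩ := frequently_atTop.1 (hacc (some m)) (i a)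
      obtain ⟨k, rfl⟩ := hnth n hn'
      exact ⟨k, hi.le_iff_le.1 hn, hF m rfl⟩
  · rintro ⟨i, q, hi, hi0, h0, hR, hacc⟩
    obtain ⟨κ, hκ⟩ := hi.exists_blockIndex hi0
    have hcut := blockIndex_cut hi hκ
    have hκ0 : κ 0 = 0 := by
      have := hcut 0
      rwa [hi0] at this
    refine ⟨fun n => (q (κ n), blockFold c₀ f w (i (κ n)) n, n = i (κ n)),
      ⟨by simpa only [hκ0] using h0, rfl, by simp only [hκ0, hi0]⟩, fun n => ?_, fun m => ?_⟩
    · have hfold := blockFold_succ c₀ f w (hκ n).1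
      dsimp only
      rw [← hfold]
      rcases blockIndex_succ hi hκ n with ⟨h₁, h₂⟩ | ⟨h₁, h₂⟩
      · rw [h₁]
        have := (hκ n).1
        exact .inr ⟨by omega, rfl, rfl⟩
      · rw [h₁, h₂]
        exact .inl ⟨rfl, hR _, blockFold_self _ _ _ _⟩
    · have key {p : ℕ → Prop} (h : ∃ᶠ k in atTop, p k) :
          ∃ᶠ n in atTop, n = i (κ n) ∧ p (κ n) := by
        rw [frequently_atTop] at *
        intro a
        obtain ⟨k, hk, hp⟩ := h a
        exact ⟨i k, hk.trans (hi.id_le k), by rw [hcut], by rwa [hcut]⟩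
      rcases m with _ | m
      · exact (key (Eventually.of_forall fun _ => trivial).frequently).mono fun n hn => ⟨hn.1, nofun⟩
      · refine (key (hacc m)).mono fun n hn => ⟨hn.1, ?_⟩
        rintro _ ⟨⟩
        exact hn.2

/-! ### Profiles of blocks -/

/-- The triples of a state, a state that can be reached from it while reading the letters of `w` at
the positions from `n` to `m - 1`, and the set of marks on the way. -/
def profile (A : TGBA S) (w : OmegaWord S) (n m : ℕ) : Set (A.Q × A.Q × Set A.Acc) :=
  blockFold {x | x.2.1 = x.1 ∧ x.2.2 = ∅}
    (fun X ℓ => {x | ∃ r M N, (x.1, r, M) ∈ X ∧ A.Step r ℓ N x.2.1 ∧ x.2.2 = M ∪ N}) w n m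

theorem profile_congr (A : TGBA S) {w w' : OmegaWord S} {n n' d : ℕ}
    (h : ∀ k < d, w (n + k) = w' (n' + k)) :
    A.profile w n (n + d) = A.profile w' n' (n' + d) :=
  blockFold_congr _ _ h

theorem mem_profile_iff {A : TGBA S} {w : OmegaWord S} {n m : ℕ} (h : n ≤ m) {p q : A.Q}
    {M : Set A.Acc} :
    (p, q, M) ∈ A.profile w n m ↔ ∃ (r : ℕ → A.Q) (N : ℕ → Set A.Acc), r n = p ∧ r m = q ∧
      (∀ k, n ≤ k → k < m → A.Step (r k) (w k) (N k) (r (k + 1))) ∧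
      M = {a | ∃ k, n ≤ k ∧ k < m ∧ a ∈ N k} := by
  induction m, h using Nat.le_induction generalizing q M with
  | base =>
    rw [profile, blockFold_self]
    have hempty (N : ℕ → Set A.Acc) : {a | ∃ k, n ≤ k ∧ k < n ∧ a ∈ N k} = ∅ := by
      refine Set.eq_empty_of_forall_notMem ?_
      rintro a ⟨k, h₁, h₂, -⟩
      omega
    constructor
    · rintro ⟨h₁, h₂⟩
      exact ⟨fun _ => p, fun _ => ∅, rfl, h₁.symm, fun k h₁ h₂ => by omega,
        Eq.trans h₂ (hempty _).symm⟩
    · rintro ⟨r, N, h₁, h₂, -, h₃⟩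
      exact ⟨h₂.symm.trans h₁, h₃.trans (hempty _)⟩
  | succ m hm ih =>
    rw [profile, blockFold_succ _ _ _ hm]
    constructor
    · rintro ⟨r, M', N', hr, hstep, hM⟩
      obtain ⟨ρ, N, h₁, h₂, h₃, h₄⟩ := ih.1 hr
      dsimp only at hstep hM
      refine ⟨fun k => if k ≤ m then ρ k else q, fun k => if k < m then N k else N',
        by simp [hm, h₁], by simp, fun k hk hk' => ?_, ?_⟩
      · rcases (Nat.lt_succ_iff.1 hk').eq_or_lt with rfl | hlt
        · simpa [h₂] using hstep
        · simpa [hlt, hlt.le, Nat.succ_le_of_lt hlt] using h₃ k hk hlt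
      · rw [hM, h₄]
        ext a
        constructor
        · rintro (⟨k, hk, hk', ha⟩ | ha)
          · exact ⟨k, hk, by omega, by simpa [hk'] using ha⟩
          · exact ⟨m, hm, by omega, by simpa using ha⟩
        · rintro ⟨k, hk, hk', ha⟩
          rcases (Nat.lt_succ_iff.1 hk').eq_or_lt with rfl | hlt
          · exact .inr (by simpa using ha)
          · exact .inl ⟨k, hk, hlt, by simpa [hlt] using ha⟩
    · rintro ⟨ρ, N, h₁, h₂, h₃, h₄⟩
      refine ⟨ρ m, {a | ∃ k, n ≤ k ∧ k < m ∧ a ∈ N k}, N m, ih.2 ⟨ρ, N, h₁, rfl, fun k hk hk' =>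
        h₃ k hk (by omega), rfl⟩, ?_, ?_⟩
      · rw [← h₂]
        exact h₃ m hm (Nat.lt_succ_self m)
      · refine Eq.trans h₄ (Set.ext fun a => ?_)
        constructor
        · rintro ⟨k, hk, hk', ha⟩
          rcases (Nat.lt_succ_iff.1 hk').eq_or_lt with rfl | hlt
          · exact .inr ha
          · exact .inl ⟨k, hk, hlt, ha⟩
        · rintro (⟨k, hk, hk', ha⟩ | ha)
          · exact ⟨k, hk, by omega, ha⟩
          · exact ⟨m, hm, by omega, ha⟩

/-- Membership in the language of `A` depends only on the profiles of the blocks of a word. -/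
theorem mem_language_iff_profile {A : TGBA S} {w : OmegaWord S} {i : ℕ → ℕ} (hi : StrictMono i)
    (hi0 : i 0 = 0) :
    w ∈ A.language ↔ ∃ (q : ℕ → A.Q) (N : ℕ → Set A.Acc), q 0 = A.init ∧
      (∀ k, (q k, q (k + 1), N k) ∈ A.profile w (i k) (i (k + 1))) ∧
      ∀ m, ∃ᶠ k in atTop, m ∈ N k := by
  obtain ⟨κ, hκ⟩ := hi.exists_blockIndex hi0
  have hlt (k : ℕ) : i k < i (k + 1) := hi (Nat.lt_succ_self k)
  have hcut := blockIndex_cut hi hκ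
  rw [mem_language_iff]
  constructor
  · rintro ⟨q, M, h0, hstep, hacc⟩
    refine ⟨fun k => q (i k), fun k => {a | ∃ n, i k ≤ n ∧ n < i (k + 1) ∧ a ∈ M n},
      by simpa only [hi0] using h0, fun k => (mem_profile_iff (hlt k).le).2
        ⟨q, M, rfl, rfl, fun n _ _ => hstep n, rfl⟩, fun m => ?_⟩
    rw [frequently_atTop]
    intro a
    obtain ⟨n, hn, hm⟩ := frequently_atTop.1 (hacc m) (i a)
    refine ⟨κ n, ?_, n, (hκ n).1, (hκ n).2, hm⟩
    have := blockIndex_mono hi hκ hn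
    rwa [hcut] at this
  · rintro ⟨q, N, h0, hN, hacc⟩
    -- One path per block; position `n` follows the path of its block `κ n`, and the paths agree at
    -- the cuts.
    choose r M h₁ h₂ h₃ h₄ using fun k => (mem_profile_iff (hlt k).le).1 (hN k)
    refine ⟨fun n => r (κ n) n, fun n => M (κ n) n, ?_, fun n => ?_, fun m => ?_⟩
    · have hκ0 := hcut 0
      rw [hi0] at hκ0
      have := h₁ 0
      rw [hi0] at this
      simp only [hκ0, this, h0]
    · have := h₃ (κ n) n (hκ n).1 (hκ n).2
      rcases blockIndex_succ hi hκ n with ⟨h, -⟩ | ⟨h, h'⟩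
      · simpa only [h] using this
      · rw [h', h₂, ← h₁, ← h'] at this
        simpa only [h] using this
    · rw [frequently_atTop]
      intro a
      obtain ⟨k, hk, hm⟩ := frequently_atTop.1 (hacc m) a
      rw [h₄] at hm
      obtain ⟨n, hn, hn', hm⟩ := hm
      refine ⟨n, hk.trans ((hi.id_le k).trans hn), ?_⟩
      simpa only [blockIndex_eq hi hκ hn hn'] using hm

/-! ### Complementation -/

/-- A weak form of the infinite Ramsey theorem for pairs. -/
theorem _root_.exists_strictMono_forall_color_eq {C : Type*} [Finite C] (c : ℕ → ℕ → C) :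
    ∃ (i : ℕ → ℕ) (e : C), StrictMono i ∧ i 0 = 0 ∧ ∀ k, c (i (k + 1)) (i (k + 2)) = e := by
  -- Along a nonprincipal ultrafilter, `d n` is the limit colour of `c n` and `e` that of `d`. After
  -- `0` all chosen points have limit colour `e`; `0` itself need not, so the first block is exempt.
  have hlim (g : ℕ → C) : ∃ e, ∀ᶠ n in hyperfilter ℕ, g n = e := by
    obtain ⟨e, -, he⟩ := (Ultrafilter.finite_biUnion_mem_iff (f := hyperfilter ℕ)
      (Set.finite_univ (α := C)) (s := fun e => {n | g n = e})).1 (univ_mem' fun n =>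
        Set.mem_biUnion (Set.mem_univ (g n)) rfl)
    exact ⟨e, he⟩
  choose d hd using fun n => hlim (c n)
  obtain ⟨e, he⟩ := hlim d
  have hgt (n : ℕ) : ∀ᶠ m in hyperfilter ℕ, n < m :=
    (Nat.cofinite_eq_atTop ▸ hyperfilter_le_cofinite) (eventually_gt_atTop n)
  have hnext (n : ℕ) : ∃ m, n < m ∧ d m = e ∧ (d n = e → c n m = e) := by
    obtain ⟨m, ⟨h₁, h₂⟩, h₃⟩ := (((hgt n).and he).and (hd n)).exists
    exact ⟨m, h₁, h₂, fun h => h₃.trans h⟩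
  choose g hg₁ hg₂ hg₃ using hnext
  refine ⟨fun k => g^[k] 0, e, strictMono_nat_of_lt_succ fun k => ?_, rfl, fun k => ?_⟩
  · rw [Function.iterate_succ_apply']
    exact hg₁ _
  · have h (j : ℕ) : g^[j + 1] 0 = g (g^[j] 0) := Function.iterate_succ_apply' g j 0
    dsimp only
    rw [h (k + 1), h k]
    exact hg₃ _ (hg₂ _)

theorem exists_language_eq_compl (A : TGBA S) : ∃ B : TGBA S, B.language = A.languageᶜ := by
  have := A.finite_Q
  have := A.finite_Acc
  -- One accepted word with profiles `s, e, e, …` would make all such words accepted, so `reject`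
  -- loses no word of the complement.
  let reject (s e : Set (A.Q × A.Q × Set A.Acc)) : Prop := ∀ (w : OmegaWord S) (i : ℕ → ℕ),
    StrictMono i → i 0 = 0 → A.profile w (i 0) (i 1) = s →
      (∀ k, A.profile w (i (k + 1)) (i (k + 2)) = e) → w ∉ A.language
  obtain ⟨B, hB⟩ := exists_language_eq_blocks (S := S)
    (Q := Option (Set (A.Q × A.Q × Set A.Acc) × Set (A.Q × A.Q × Set A.Acc))) (Acc := Empty)
    {x | x.2.1 = x.1 ∧ x.2.2 = ∅}
    (fun X ℓ => {x | ∃ r M N, (x.1, r, M) ∈ X ∧ A.Step r ℓ N x.2.1 ∧ x.2.2 = M ∪ N}) {none}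
    -- The first block fixes `s` and guesses `e`; each later block must have profile `e`.
    (fun x X y => (x = none ∧ ∃ e, y = some (X, e) ∧ reject X e) ∨
      ∃ s, x = some (s, X) ∧ y = some (s, X)) nofun
  refine ⟨B, hB.trans (Set.ext fun w => ?_)⟩
  constructor
  · rintro ⟨i, q, hi, hi0, h0, hR, -⟩
    rcases hR 0 with ⟨-, e, h1, hrej⟩ | ⟨s, h1, -⟩
    · have hq (k : ℕ) : q (k + 1) = some (A.profile w (i 0) (i 1), e) := by
        induction k with
        | zero => exact h1
        | succ k ih =>
          rcases hR (k + 1) with ⟨h, -⟩ | ⟨s, h, h'⟩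
          · rw [ih] at h
            cases h
          · rw [h', ← h, ih]
      refine hrej w i hi hi0 rfl fun k => ?_
      rcases hR (k + 1) with ⟨h, -⟩ | ⟨s, h, -⟩
      · rw [hq] at h
        cases h
      · rw [hq] at h
        exact (Prod.mk.inj (Option.some.inj h)).2.symm
    · rw [h1] at h0
      cases h0
  · intro hw
    obtain ⟨i, e, hi, hi0, he⟩ := exists_strictMono_forall_color_eq (A.profile w)
    refine ⟨i, fun k => if k = 0 then none else some (A.profile w (i 0) (i 1), e), hi, hi0, rfl,
      fun k => ?_, nofun⟩
    rcases k with _ | k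
    · refine .inl ⟨rfl, e, rfl, fun w' j hj hj0 hs he' hw' => hw ?_⟩
      rw [mem_language_iff_profile hi hi0]
      obtain ⟨q, N, h0, hq, hN⟩ := (mem_language_iff_profile hj hj0).1 hw'
      refine ⟨q, N, h0, fun k => ?_, hN⟩
      rcases k with _ | k
      · have := hq 0
        rwa [hs] at this
      · rw [he, ← he' k]
        exact hq (k + 1)
    · refine .inr ⟨A.profile w (i 0) (i 1), ?_, ?_⟩ <;>
      · rw [← he k]
        rfl

/-! ### Closure under stuttering -/

/-- The repetition count `d` is unbounded but need not be stored: only a triple in the profile of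
`d` copies of the letter matters. -/
theorem exists_language_eq_stutterClosure (A : TGBA S) :
    ∃ B : TGBA S, B.language = {w | ∃ w' ∈ A.language, StutterEquiv w w'} := by
  have := A.finite_Q
  have := A.finite_Acc
  obtain ⟨B, hB⟩ := exists_language_eq_blocks (S := S) (Q := A.Q × Set A.Acc) (Acc := A.Acc)
    (C := Set (Letter S)) ∅ (fun X ℓ => insert ℓ X) {x | x.1 = A.init}
    (fun x X y => ∃ (ℓ : Letter S) (d : ℕ), X = {ℓ} ∧ 0 < d ∧
      (x.1, y.1, y.2) ∈ A.profile (fun _ => ℓ) 0 (0 + d)) (fun m => {x | m ∈ x.2})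
  refine ⟨B, hB.trans (Set.ext fun w => ?_)⟩
  constructor
  · rintro ⟨i, q, hi, hi0, h0, hR, hacc⟩
    choose ℓ d hℓ hd hprof using hR
    obtain ⟨j, hj0, hjs⟩ : ∃ j : ℕ → ℕ, j 0 = 0 ∧ ∀ k, j (k + 1) = j k + d k :=
      ⟨Nat.rec 0 fun k n => n + d k, rfl, fun _ => rfl⟩
    have hj : StrictMono j := strictMono_nat_of_lt_succ fun k => by
      have := hd k
      rw [hjs]
      omega
    obtain ⟨κ, hκ⟩ := hj.exists_blockIndex hj0
    refine ⟨fun n => ℓ (κ n), ?_, i, j, hi, hj, hi0, hj0, fun k m n h₁ h₂ h₃ h₄ => ?_⟩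
    · rw [mem_language_iff_profile hj hj0]
      refine ⟨fun k => (q k).1, fun k => (q (k + 1)).2, h0, fun k => ?_, fun m =>
        frequently_succ_iff (p := fun k => m ∈ (q k).2).2 (hacc m)⟩
      have : A.profile (fun n => ℓ (κ n)) (j k) (j k + d k) =
          A.profile (fun _ => ℓ k) 0 (0 + d k) := A.profile_congr fun n hn => by
        rw [blockIndex_eq hj hκ (Nat.le_add_right _ _) (by rw [hjs]; omega)]
      rw [hjs, this]
      exact hprof k
    · have : w m ∈ blockFold (∅ : Set (Letter S)) (fun X ℓ => insert ℓ X) w (i k) (i (k + 1)) :=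
        (mem_blockFold_insert w (hi (Nat.lt_succ_self k)).le).2 ⟨m, h₁, h₂, rfl⟩
      rw [hℓ] at this
      dsimp only
      rw [blockIndex_eq hj hκ h₃ h₄]
      exact this
  · rintro ⟨w', hw', i, j, hi, hj, hi0, hj0, h⟩
    obtain ⟨q, N, h0, hq, hN⟩ := (mem_language_iff_profile hj hj0).1 hw'
    have hlt (k : ℕ) : i k < i (k + 1) := hi (Nat.lt_succ_self k)
    have hlt' (k : ℕ) : j k < j (k + 1) := hj (Nat.lt_succ_self k)
    -- A state carries the marks of the block just read; the value at `k = 0` is arbitrary.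
    refine ⟨i, fun k => (q k, N (k - 1)), hi, hi0, h0, fun k => ?_, fun m =>
      frequently_succ_iff (p := fun k => m ∈ N (k - 1)).1 (hN m)⟩
    refine ⟨w' (j k), j (k + 1) - j k, Set.ext fun ℓ => ?_, Nat.sub_pos_of_lt (hlt' k), ?_⟩
    · rw [mem_blockFold_insert w (hlt k).le, Set.mem_singleton_iff]
      constructor
      · rintro ⟨m, h₁, h₂, rfl⟩
        exact h k m _ h₁ h₂ le_rfl (hlt' k)
      · rintro rfl
        exact ⟨i k, le_rfl, hlt k, h k _ _ le_rfl (hlt k) le_rfl (hlt' k)⟩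
    · have : A.profile w' (j k) (j k + (j (k + 1) - j k)) =
          A.profile (fun _ => w' (j k)) 0 (0 + (j (k + 1) - j k)) := A.profile_congr fun n hn =>
        (h k _ _ le_rfl (hlt k) (Nat.le_add_right _ _) (by omega)).symm.trans
          (h k _ _ le_rfl (hlt k) le_rfl (hlt' k))
      rw [← this, Nat.add_sub_cancel' (hlt' k).le]
      exact hq k

end TGBA

/-! ### Products -/

theorem BoolFormula.eval_map {α β : Type*} (r : α → β) (ℓ : Letter β) (f : BoolFormula α) :
    (f.map r).eval ℓ = f.eval (fun p => ℓ (r p)) := by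
  induction f with
  | tru => rfl
  | fls => rfl
  | atom p => rfl
  | neg f ih => simp only [map, eval, ih]
  | conj f g ih₁ ih₂ => simp only [map, eval, ih₁, ih₂]
  | disj f g ih₁ ih₂ => simp only [map, eval, ih₁, ih₂]

namespace TGBA

variable {P : Type*} [DecidableEq P] {S T U : Finset P}

/-- Since the marks are kept disjoint, a joint run is accepting exactly when both its components
are. -/
theorem mem_language_prod {A : TGBA S} {B : TGBA T} {hU : S ∪ T = U} {w : OmegaWord U} :
    w ∈ (A.prod B hU).language ↔
      (fun n (p : S) => w n ⟨p.1, hU ▸ Finset.mem_union_left T p.2⟩) ∈ A.language ∧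
      (fun n (p : T) => w n ⟨p.1, hU ▸ Finset.mem_union_right S p.2⟩) ∈ B.language := by
  simp only [language, IsRun, IsAccepting]
  constructor
  · rintro ⟨ρ, ⟨h0, hρ⟩, hacc⟩
    choose t₁ ht₁ t₂ ht₂ ht using fun n => (hρ n).1
    have hsrc (n : ℕ) : (t₁ n).dst = (t₁ (n + 1)).src ∧ (t₂ n).dst = (t₂ (n + 1)).src := by
      have := (hρ n).2.1
      rw [ht n, ht (n + 1)] at this
      exact Prod.mk.inj this
    have hinit : (t₁ 0).src = A.init ∧ (t₂ 0).src = B.init := by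
      rw [ht 0] at h0
      exact Prod.mk.inj h0
    have hlabel (n : ℕ) := (hρ n).2.2
    simp only [ht, BoolFormula.eval, BoolFormula.eval_map, Bool.and_eq_true] at hlabel
    refine ⟨⟨t₁, ⟨hinit.1, fun n => ⟨ht₁ n, (hsrc n).1, (hlabel n).1⟩⟩, fun m => ?_⟩,
      ⟨t₂, ⟨hinit.2, fun n => ⟨ht₂ n, (hsrc n).2, (hlabel n).2⟩⟩, fun m => ?_⟩⟩
    · refine (hacc (.inl m)).mono fun n (hn : Sum.inl m ∈ (ρ n).marks) => ?_
      rw [ht n] at hn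
      obtain ⟨_, hm, ⟨⟩⟩ | ⟨_, _, ⟨⟩⟩ := hn
      exact hm
    · refine (hacc (.inr m)).mono fun n (hn : Sum.inr m ∈ (ρ n).marks) => ?_
      rw [ht n] at hn
      obtain ⟨_, _, ⟨⟩⟩ | ⟨_, hm, ⟨⟩⟩ := hn
      exact hm
  · rintro ⟨⟨t₁, ⟨h0₁, h₁⟩, hacc₁⟩, ⟨t₂, ⟨h0₂, h₂⟩, hacc₂⟩⟩
    refine ⟨_, ⟨?_, fun n => ⟨⟨t₁ n, (h₁ n).1, t₂ n, (h₂ n).1, rfl⟩, ?_, ?_⟩⟩, ?_⟩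
    · exact Prod.ext h0₁ h0₂
    · exact Prod.ext (h₁ n).2.1 (h₂ n).2.1
    · simp only [BoolFormula.eval, BoolFormula.eval_map, Bool.and_eq_true]
      exact ⟨(h₁ n).2.2, (h₂ n).2.2⟩
    · rintro (m | m)
      · exact (hacc₁ m).mono fun n hn => .inl ⟨m, hn, rfl⟩
      · exact (hacc₂ m).mono fun n hn => .inr ⟨m, hn, rfl⟩

theorem mem_language_prod_self {A B : TGBA S} {w : OmegaWord S} :
    w ∈ (A.prod B (Finset.union_self S)).language ↔ w ∈ A.language ∧ w ∈ B.language :=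
  mem_language_prod

/-! ### Relaxation and restriction relative to a second automaton -/

theorem language_prod_siRelax {si co : Operation P} (hsi : IsStutterClosure si)
    (hco : IsComplementation co) (A : TGBA S) (B : TGBA T) :
    ((siRelax si co A B).prod B rfl).language = (A.prod B rfl).language := by
  unfold siRelax
  split_ifs with h
  · ext w
    have hw := Set.eq_empty_iff_forall_notMem.1 h w
    rw [mem_language_prod, mem_language_prod_self, hco] at hw
    rw [mem_language_prod, mem_language_prod]
    refine ⟨fun ⟨h₁, h₂⟩ => ⟨?_, h₂⟩, fun ⟨h₁, h₂⟩ => ⟨(hsi S A).1.2 h₁, h₂⟩⟩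
    -- A word gained by relaxing would lie in the product that is assumed empty.
    by_contra h₃
    exact hw ⟨⟨h₁, h₃⟩, h₂⟩
  · rfl

theorem language_prod_siRestrict (si : Operation P) {co : Operation P}
    (hco : IsComplementation co) (A : TGBA S) (B : TGBA T) :
    ((siRestrict si co A B).prod B rfl).language = (A.prod B rfl).language := by
  unfold siRestrict
  split_ifs with h
  · ext w
    have hw := Set.eq_empty_iff_forall_notMem.1 h w
    rw [mem_language_prod] at hw
    rw [mem_language_prod (B := B), mem_language_prod (B := B), mem_language_prod_self, hco]
    exact ⟨fun ⟨⟨h₁, _⟩, h₂⟩ => ⟨h₁, h₂⟩, fun ⟨h₁, h₂⟩ => ⟨⟨h₁, fun h₃ => hw ⟨h₃, h₂⟩⟩, h₂⟩⟩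
  · rfl

end TGBA

theorem theorem4 {P : Type*} [DecidableEq P] :
    (∃ si : TGBA.Operation P, TGBA.IsStutterClosure si) ∧
    (∃ co : TGBA.Operation P, TGBA.IsComplementation co) ∧
    (∃ tr : (S : Finset P) → LTL S → TGBA S, TGBA.IsTranslation tr) ∧
    ∀ (si co : TGBA.Operation P) (tr : (S : Finset P) → LTL S → TGBA S),
      TGBA.IsStutterClosure si → TGBA.IsComplementation co → TGBA.IsTranslation tr →
      ∀ (S T : Finset P) (A : TGBA S) (K : LTL T), StutterSensitive A.language →
        ((TGBA.siRelax si co A (tr T K)).prod (tr T K) rfl).language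
            = (A.prod (tr T K) rfl).language ∧
        ((TGBA.siRestrict si co A (tr T K)).prod (tr T K) rfl).language
            = (A.prod (tr T K) rfl).language := by
  refine ⟨?_, ?_, ?_, fun si co tr hsi hco _ S T A K _ =>
    ⟨TGBA.language_prod_siRelax hsi hco A _, TGBA.language_prod_siRestrict si hco A _⟩⟩
  · choose si hsi using fun (S : Finset P) (A : TGBA S) => A.exists_language_eq_stutterClosure
    refine ⟨si, fun S A => ?_⟩
    rw [hsi]
    exact isLeast_stutterClosure _
  · choose co hco using fun (S : Finset P) (A : TGBA S) => A.exists_language_eq_compl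
    exact ⟨co, hco⟩
  · choose tr htr using fun (S : Finset P) (φ : LTL S) => φ.exists_language_eq
    exact ⟨tr, htr⟩
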